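/- Let $m,N\ge 0$ be integers, $M=2^m$, and for $0\le i\le M-1$ let $n_{i,k}\in\{0,1\}$ ($k=0,\dots,m-1$) be the coefficient of $2^k$ in the binary representation of $i$; write $\bar u=1-u$ for a bit $u$. Let $C_0,\dots,C_{m-1}$ be independent random bits with $P_{C_k}(u)=\Pr[C_k=u]$ and $0<P_{C_k}(0)<1$. Let $x_0,\dots,x_{M-1}\in\mathbb{R}^N$ be symbols, not all zero. The transmitted vector $X$ is the symbol $x_i$ whose index satisfies $n_{i,k}=C_k$ for all $k$; thus the index $i$ has probability $P_i=\prod_{k=0}^{m-1}P_{C_k}(n_{i,k})$. The received vector is $Y=H\circ X+Z$ (element-wise product), where $X,H,Z$ are independent, $Z$ is Gaussian with independent coordinates of mean zero and variance $N_0/2$ (with $N_0>0$), and $H$ is a random vector in $\mathbb{R}^N$ whose real coordinates, possibly dependent, all have the same law as a random variable $H_*$ with $0<\mathbb{E}[H_*^2]<\infty$. Put $\boldsymbol\mu=\mathbb{E}[X]$, $E_s=\mathbb{E}[\|X\|^2]$, $\mathrm{SNR}=\mathbb{E}[H_*^2]E_s/N_0$, and let the BICM generalized mutual information be $$I=\sum_{k=0}^{m-1}I(C_k;Y\mid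 H),\qquad I(C_k;Y\mid H)=\mathbb{E}\left[\log_2\frac{p_{Y|H,C_k}(Y|H,C_k)}{p_{Y|H}(Y|H)}\right].$$ Then $$\boldsymbol\mu=\sum_{i=0}^{M-1}P_i x_i,\qquad E_s=\sum_{i=0}^{M-1}P_i\|x_i\|^2 .$$ The random variables in the definition of $I(C_k;Y\mid H)$ are integrable. When $N_0>0$ is varied, and when the alphabet is replaced by $(r x_i)_i$ with $r\ge 0$ (and $E_s$ accordingly), the value $I$ depends only on $\mathrm{SNR}$, so that $I=I(\mathrm{SNR})$ is a function on $[0,\infty)$. This function has a (right) derivative $\alpha=\left.\frac{dI(\mathrm{SNR})}{d\,\mathrm{SNR}}\right|_{\mathrm{SNR}=0}$, and, with $E_s$ the energy of the original alphabet, $$\alpha=\frac{\log_2 e}{E_s}\sum_{i=0}^{M-1}P_i\sum_{j=0}^{M-1}P_j\langle x_i,x_j\rangle\sum_{k=0}^{m-1}(-1)^{n_{i,k}+n_{j,k}}\frac{P_{C_k}(\bar n_{i,k})}{P_{C_k}(n_{j,k})}.$$ -/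

import Mathlib

open MeasureTheory

noncomputable section

namespace BICM

/-- The bit `n_{i,k}` of the natural binary code: the coefficient of `2 ^ k` in the base-2
representation of `i`, so that `k = m - 1` is the most significant position. -/
def nbc {m : ℕ} (i : Fin (2 ^ m)) (k : Fin m) : Fin 2 :=
  ⟨(i : ℕ) / 2 ^ (k : ℕ) % 2, Nat.mod_lt _ two_pos⟩

/-- Element-wise product of two vectors. -/
def hadamard {N : ℕ} (a b : EuclideanSpace ℝ (Fin N)) : EuclideanSpace ℝ (Fin N) :=
  WithLp.toLp 2 fun l => a l * b l

/-- A constellation with `2 ^ m` symbols in `ℝ^N`, labelled by the natural binary code. The input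
distribution is specified by the bit probabilities `b k`, the probability that bit `k` is `0`. -/
structure Constellation (m N : ℕ) where
  /-- the input alphabet -/
  x : Fin (2 ^ m) → EuclideanSpace ℝ (Fin N)
  /-- the probability that bit `k` is `0` -/
  b : Fin m → ℝ
  b_pos : ∀ k, 0 < b k
  b_lt_one : ∀ k, b k < 1

namespace Constellation

variable {m N : ℕ}

/-- The probability `P_{C_k}(u)` that bit `k` equals `u`. -/
def bitProb (C : Constellation m N) (k : Fin m) (u : Fin 2) : ℝ :=
  if u = 0 then C.b k else 1 - C.b k

/-- The symbol probability `P_i`. -/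
def symbolProb (C : Constellation m N) (i : Fin (2 ^ m)) : ℝ :=
  ∏ k, C.bitProb k (nbc i k)

/-- The law of the bit vector `(C_0, …, C_{m-1})`: independent bits. -/
def bitsLaw (C : Constellation m N) : Measure (Fin m → Fin 2) :=
  Measure.pi fun k => ∑ u : Fin 2, ENNReal.ofReal (C.bitProb k u) • Measure.dirac u

/-- The mapper: a bit vector `c` is sent to the symbol whose index is `∑ k, c k * 2 ^ k`. -/
def symbol (C : Constellation m N) (c : Fin m → Fin 2) : EuclideanSpace ℝ (Fin N) :=
  C.x (finFunctionFinEquiv c)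

/-- The mean `E[X]` of the transmitted symbol. -/
def mean (C : Constellation m N) : EuclideanSpace ℝ (Fin N) :=
  ∫ c, C.symbol c ∂C.bitsLaw

/-- The average symbol energy `E_s = E[‖X‖²]`. -/
def energy (C : Constellation m N) : ℝ :=
  ∫ c, ‖C.symbol c‖ ^ 2 ∂C.bitsLaw

/-- The alphabet rescaled linearly, with the same input distribution. -/
def scale (C : Constellation m N) (r : ℝ) : Constellation m N :=
  { C with x := fun i => r • C.x i }

end Constellation

variable {m N : ℕ}

/-- The transition pdf `p_{Y|X,H}(y|x,h)` of the channel `Y = H ∘ X + Z`. -/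
def channelPdf (N₀ : ℝ) (y x h : EuclideanSpace ℝ (Fin N)) : ℝ :=
  1 / (N₀ * Real.pi) ^ ((N : ℝ) / 2) * Real.exp (-‖y - hadamard h x‖ ^ 2 / N₀)

/-- The pdf `p_{Y|H}(y|h)`. -/
def outputPdf (C : Constellation m N) (N₀ : ℝ) (y h : EuclideanSpace ℝ (Fin N)) : ℝ :=
  ∑ i, C.symbolProb i * channelPdf N₀ y (C.x i) h

/-- The pdf `p_{Y|H,C_k}(y|h,u)`. -/
def bitOutputPdf (C : Constellation m N) (N₀ : ℝ) (k : Fin m) (y h : EuclideanSpace ℝ (Fin N))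
    (u : Fin 2) : ℝ :=
  ∑ i with nbc i k = u, C.symbolProb i / C.bitProb k u * channelPdf N₀ y (C.x i) h

/-- The law of the noise `Z`: i.i.d. Gaussian coordinates with mean `0` and variance `N₀ / 2`. -/
def noiseLaw (N : ℕ) (N₀ : ℝ) : Measure (EuclideanSpace ℝ (Fin N)) :=
  volume.withDensity fun z =>
    ENNReal.ofReal (1 / (N₀ * Real.pi) ^ ((N : ℝ) / 2) * Real.exp (-‖z‖ ^ 2 / N₀))

/-- The joint law of the bits, the fading vector `H` (with law `ν`) and the noise `Z`, which are
independent of each other. -/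
def jointLaw (C : Constellation m N) (ν : Measure (EuclideanSpace ℝ (Fin N))) (N₀ : ℝ) :
    Measure ((Fin m → Fin 2) × EuclideanSpace ℝ (Fin N) × EuclideanSpace ℝ (Fin N)) :=
  C.bitsLaw.prod (ν.prod (noiseLaw N N₀))

/-- The received vector `Y = H ∘ X + Z`. -/
def received (C : Constellation m N)
    (ω : (Fin m → Fin 2) × EuclideanSpace ℝ (Fin N) × EuclideanSpace ℝ (Fin N)) :
    EuclideanSpace ℝ (Fin N) :=
  hadamard ω.2.1 (C.symbol ω.1) + ω.2.2

/-- The information density `log₂ (p_{Y|H,C_k}(Y|H,C_k) / p_{Y|H}(Y|H))`. -/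
def infoDensity (C : Constellation m N) (N₀ : ℝ) (k : Fin m)
    (ω : (Fin m → Fin 2) × EuclideanSpace ℝ (Fin N) × EuclideanSpace ℝ (Fin N)) : ℝ :=
  Real.logb 2 (bitOutputPdf C N₀ k (received C ω) ω.2.1 (ω.1 k) /
    outputPdf C N₀ (received C ω) ω.2.1)

/-- The mutual information `I(C_k; Y | H)` in bits per channel use. -/
def bitMI (C : Constellation m N) (ν : Measure (EuclideanSpace ℝ (Fin N))) (N₀ : ℝ)
    (k : Fin m) : ℝ :=
  ∫ ω, infoDensity C N₀ k ω ∂jointLaw C ν N₀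

/-- The BICM generalized mutual information `∑ k, I(C_k; Y | H)`. -/
def bicmGMI (C : Constellation m N) (ν : Measure (EuclideanSpace ℝ (Fin N))) (N₀ : ℝ) : ℝ :=
  ∑ k, bitMI C ν N₀ k

/-- The second moment `E[H²]` of a fading coefficient with law `pH`. -/
def secondMoment (pH : Measure ℝ) : ℝ := ∫ t, t ^ 2 ∂pH

/-- The signal-to-noise ratio `E[H²] E_s / N₀`. -/
def snr (C : Constellation m N) (pH : Measure ℝ) (N₀ : ℝ) : ℝ :=
  secondMoment pH * C.energy / N₀

/-- The BICM-GMI as a function of the SNR: the alphabet is rescaled, at noise level `N₀ = 1`,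
so that the SNR becomes `s`. -/
def gmiOfSNR (C : Constellation m N) (ν : Measure (EuclideanSpace ℝ (Fin N))) (pH : Measure ℝ)
    (s : ℝ) : ℝ :=
  bicmGMI (C.scale (Real.sqrt (s / (secondMoment pH * C.energy)))) ν 1

end BICM

end

/-!
Given the fading vector, the output is Gaussian noise plus a random signal, so each `I(C_k; Y | H)`
is the mean over `u` of the relative entropy, with respect to the noise, of the output given
`C_k = u`, minus the relative entropy of the unconditioned output. Since `klFun (1 + t) ~ t ^ 2 / 2`
and the likelihood ratio of a signal `r a` of mean `r μ` is `1 + r ⟪z, μ⟫ + O(r ^ 2)`, its relative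
entropy is `r ^ 2 ‖μ‖ ^ 2 / 2 + o(r ^ 2)`, whence the slope of `I(C_k; Y | H)` is proportional to
the variance `∑ u, P(C_k = u) ‖E[X | C_k = u]‖ ^ 2 - ‖E[X]‖ ^ 2` of the conditional means. Averaging
over the fading is a dominated convergence: by convexity the relative entropy is at most half the
energy of the signal. Expanding the variance into inner products gives the formula.
-/

noncomputable section

namespace BICM

open ProbabilityTheory InformationTheory Filter Asymptotics Set
open scoped Topology Real ENNReal

section Likelihood

variable {V : Type*} [NormedAddCommGroup V] [InnerProductSpace ℝ V]

/-- The log-likelihood ratio of `a + Z` with respect to `Z`, for `Z` standard Gaussian. -/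
def logLikelihood (a z : V) : ℝ := inner ℝ z a - ‖a‖ ^ 2 / 2

/-- The likelihood ratio of `a + Z` with respect to `Z`, for `Z` standard Gaussian. -/
def likelihood (a z : V) : ℝ := Real.exp (logLikelihood a z)

theorem likelihood_pos (a z : V) : 0 < likelihood a z := Real.exp_pos _

@[fun_prop]
theorem continuous_likelihood : Continuous fun p : V × V => likelihood p.1 p.2 := by
  unfold likelihood logLikelihood
  fun_prop

theorem exp_neg_sq_norm_sub (a z : V) :
    Real.exp (-‖z - a‖ ^ 2 / 2) = Real.exp (-‖z‖ ^ 2 / 2) * likelihood a z := by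
  rw [likelihood, logLikelihood, ← Real.exp_add, norm_sub_sq_real]
  ring_nf

theorem logLikelihood_add_self (a z : V) :
    logLikelihood a (a + z) = inner ℝ z a + ‖a‖ ^ 2 / 2 := by
  rw [logLikelihood, inner_add_left, real_inner_self_eq_norm_sq]
  ring

theorem klFun_likelihood (a z : V) :
    klFun (likelihood a z) = likelihood a z * logLikelihood a z + 1 - likelihood a z := by
  rw [klFun_apply, likelihood, Real.log_exp]

end Likelihood

section StandardGaussian

variable {V : Type*} [NormedAddCommGroup V] [InnerProductSpace ℝ V] [FiniteDimensional ℝ V]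
  [MeasurableSpace V] [BorelSpace V]

theorem integral_exp_neg_mul_sq_norm_mul_exp_inner_mul_I {b : ℝ} (hb : 0 < b) (t : V) :
    ∫ z : V, (Real.exp (-b * ‖z‖ ^ 2) : ℂ) * Complex.exp (inner ℝ z t * Complex.I) =
      ((π / b) ^ ((Module.finrank ℝ V : ℝ) / 2) : ℝ) * Real.exp (-‖t‖ ^ 2 / (4 * b)) := by
  have h := GaussianFourier.integral_cexp_neg_mul_sq_norm_add (V := V) (b := b)
    (by simpa using hb) Complex.I t
  rw [Complex.ofReal_cpow (by positivity)]
  push_cast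
  rw [Complex.I_sq, neg_one_mul] at h
  rw [← h]
  refine integral_congr_ae (.of_forall fun z => ?_)
  dsimp only
  rw [← Complex.exp_add, real_inner_comm, mul_comm Complex.I]

theorem map_sqrt_smul_stdGaussian {v : ℝ} (hv : 0 < v) :
    (stdGaussian V).map (√v • ·) = volume.withDensity fun z => ENNReal.ofReal
      (1 / (2 * π * v) ^ ((Module.finrank ℝ V : ℝ) / 2) * Real.exp (-‖z‖ ^ 2 / (2 * v))) := by
  set K : ℝ := (2 * π * v) ^ ((Module.finrank ℝ V : ℝ) / 2)
  have hK : 0 < K := by positivity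
  have hexp (z : V) : -‖z‖ ^ 2 / (2 * v) = -(2 * v)⁻¹ * ‖z‖ ^ 2 := by ring
  have hint : Integrable fun z : V => 1 / K * Real.exp (-‖z‖ ^ 2 / (2 * v)) := by
    simp only [hexp]
    refine (Integrable.of_integral_ne_zero ?_).const_mul _
    rw [GaussianFourier.integral_rexp_neg_mul_sq_norm (by positivity)]
    positivity
  have := isFiniteMeasure_withDensity_ofReal hint.2
  have := Measure.isProbabilityMeasure_map (μ := stdGaussian V) (f := (√v • · : V → V))
    (by fun_prop)
  refine Measure.ext_of_charFun (funext fun t => ?_)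
  rw [charFun_map_smul, charFun_stdGaussian, charFun_apply,
    integral_withDensity_eq_integral_toReal_smul (by fun_prop) (by simp)]
  have hsmul (z : V) :
      (ENNReal.ofReal (1 / K * Real.exp (-‖z‖ ^ 2 / (2 * v)))).toReal •
          Complex.exp (inner ℝ z t * Complex.I) =
        (K⁻¹ : ℝ) * ((Real.exp (-(2 * v)⁻¹ * ‖z‖ ^ 2) : ℂ) *
          Complex.exp (inner ℝ z t * Complex.I)) := by
    rw [ENNReal.toReal_ofReal (by positivity), hexp, Complex.real_smul, one_div,
      Complex.ofReal_mul, mul_assoc]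
  simp only [hsmul]
  rw [integral_const_mul,
    integral_exp_neg_mul_sq_norm_mul_exp_inner_mul_I (by positivity), ← mul_assoc,
    ← Complex.ofReal_mul, show π / (2 * v)⁻¹ = 2 * π * v by field_simp, inv_mul_cancel₀ hK.ne',
    Complex.ofReal_one, one_mul]
  have hnorm : -‖√v • t‖ ^ 2 / 2 = -‖t‖ ^ 2 / (4 * (2 * v)⁻¹) := by
    rw [norm_smul, mul_pow, Real.norm_of_nonneg (Real.sqrt_nonneg v), Real.sq_sqrt hv.le]
    field_simp
    norm_num
  rw [← hnorm]
  push_cast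
  rfl

theorem integral_inner_stdGaussian (a : V) : ∫ z, inner ℝ z a ∂stdGaussian V = 0 := by
  simpa [real_inner_comm] using integral_strongDual_stdGaussian (innerSL ℝ a)

theorem integrable_inner_stdGaussian (a : V) :
    Integrable (fun z => inner ℝ z a) (stdGaussian V) :=
  IsGaussian.integrable_id.inner_const a

theorem integral_sq_inner_stdGaussian (a : V) :
    ∫ z, inner ℝ z a ^ 2 ∂stdGaussian V = ‖a‖ ^ 2 := by
  have h := covarianceBilin_apply (IsGaussian.memLp_two_id (μ := stdGaussian V)) a a
  simp only [id_eq, covarianceBilin_stdGaussian, integral_id_stdGaussian] at h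
  rw [← real_inner_self_eq_norm_sq]
  simpa only [sub_zero, real_inner_comm a, ← sq] using h.symm.trans (innerSL_apply_apply ℝ a a)

theorem integrable_exp_mul_norm (γ : Measure V) [IsGaussian γ] (c : ℝ) :
    Integrable (fun z => Real.exp (c * ‖z‖)) γ := by
  obtain ⟨C, hC, hint⟩ := IsGaussian.exists_integrable_exp_sq γ
  refine (hint.const_mul (Real.exp (c ^ 2 / (4 * C)))).mono' (by fun_prop) (.of_forall fun z => ?_)
  have hsq : c * ‖z‖ ≤ c ^ 2 / (4 * C) + C * ‖z‖ ^ 2 := by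
    have h : c ^ 2 / (4 * C) + C * ‖z‖ ^ 2 - c * ‖z‖ = C * (‖z‖ - c / (2 * C)) ^ 2 := by
      field_simp
      ring
    have : 0 ≤ C * (‖z‖ - c / (2 * C)) ^ 2 := by positivity
    linarith
  rw [Real.norm_of_nonneg (Real.exp_pos _).le, ← Real.exp_add]
  exact Real.exp_le_exp.2 hsq

theorem map_add_left_stdGaussian (a : V) :
    (stdGaussian V).map (a + ·) =
      (stdGaussian V).withDensity fun z => ENNReal.ofReal (likelihood a z) := by
  have hdens := map_sqrt_smul_stdGaussian (V := V) one_pos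
  simp only [Real.sqrt_one, one_smul, Measure.map_id', mul_one] at hdens
  rw [hdens]
  refine Measure.ext fun s hs => ?_
  rw [← lintegral_indicator_one hs, ← lintegral_indicator_one hs,
    lintegral_map (by measurability) (by fun_prop),
    lintegral_withDensity_eq_lintegral_mul _ (by fun_prop) (by measurability),
    lintegral_withDensity_eq_lintegral_mul _ (by fun_prop) (by measurability),
    lintegral_withDensity_eq_lintegral_mul _ (by fun_prop) (by measurability),
    ← lintegral_sub_right_eq_self _ a]
  refine lintegral_congr fun z => ?_
  simp only [Pi.mul_apply, add_sub_cancel, exp_neg_sq_norm_sub]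
  rw [← mul_assoc (1 / _), ENNReal.ofReal_mul (by positivity) (q := likelihood a z), mul_assoc]

theorem integral_add_left_stdGaussian (a : V) (f : V → ℝ) :
    ∫ z, f (a + z) ∂stdGaussian V = ∫ z, likelihood a z * f z ∂stdGaussian V := by
  rw [← (measurableEmbedding_addLeft a).integral_map, map_add_left_stdGaussian,
    integral_withDensity_eq_integral_toReal_smul (by fun_prop) (by simp)]
  simp only [ENNReal.toReal_ofReal (likelihood_pos _ _).le, smul_eq_mul]

theorem integrable_add_left_stdGaussian_iff (a : V) {f : V → ℝ} :
    Integrable (fun z => f (a + z)) (stdGaussian V) ↔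
      Integrable (fun z => likelihood a z * f z) (stdGaussian V) := by
  rw [← Function.comp_def, ← (measurableEmbedding_addLeft a).integrable_map_iff,
    map_add_left_stdGaussian, integrable_withDensity_iff_integrable_smul' (by fun_prop) (by simp)]
  simp only [ENNReal.toReal_ofReal (likelihood_pos _ _).le, smul_eq_mul]

theorem integrable_likelihood (a : V) : Integrable (likelihood a) (stdGaussian V) := by
  simpa using (integrable_add_left_stdGaussian_iff a (f := fun _ => (1 : ℝ))).1 (integrable_const _)

theorem integral_likelihood (a : V) : ∫ z, likelihood a z ∂stdGaussian V = 1 := by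
  simpa using (integral_add_left_stdGaussian a fun _ => (1 : ℝ)).symm

theorem integrable_likelihood_mul_logLikelihood (a : V) :
    Integrable (fun z => likelihood a z * logLikelihood a z) (stdGaussian V) := by
  rw [← integrable_add_left_stdGaussian_iff]
  simp only [logLikelihood_add_self]
  exact (integrable_inner_stdGaussian a).add (integrable_const _)

theorem integrable_klFun_likelihood (a : V) :
    Integrable (fun z => klFun (likelihood a z)) (stdGaussian V) := by
  simp only [klFun_likelihood]
  exact ((integrable_likelihood_mul_logLikelihood a).add (integrable_const 1)).sub
    (integrable_likelihood a)

theorem integral_klFun_likelihood (a : V) :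
    ∫ z, klFun (likelihood a z) ∂stdGaussian V = ‖a‖ ^ 2 / 2 := by
  have hlog := integrable_likelihood_mul_logLikelihood a
  simp only [klFun_likelihood]
  rw [integral_sub (by exact hlog.add (integrable_const 1)) (integrable_likelihood a),
    integral_add hlog (integrable_const 1), integral_likelihood,
    ← integral_add_left_stdGaussian a (logLikelihood a)]
  simp only [logLikelihood_add_self]
  rw [integral_add (integrable_inner_stdGaussian a) (integrable_const _),
    integral_inner_stdGaussian]
  simp

end StandardGaussian

section KLFun

theorem klFun_le_sq_sub_one {x : ℝ} (hx : 0 < x) : klFun x ≤ (x - 1) ^ 2 := by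
  rw [klFun_apply]
  nlinarith [Real.log_le_sub_one_of_pos hx]

theorem abs_exp_sub_one_le_mul_exp_abs (t : ℝ) : |Real.exp t - 1| ≤ |t| * Real.exp |t| := by
  have h : ‖(Real.exp t : ℂ) - (1 : ℝ)‖ ≤ |t| * Real.exp |t| := by
    simpa using Complex.norm_exp_sub_sum_le_norm_mul_exp t 1
  rwa [← Complex.ofReal_sub, Complex.norm_real] at h

theorem tendsto_klFun_div_sq_sub_one :
    Tendsto (fun x => klFun x / (x - 1) ^ 2) (𝓝[≠] 1) (𝓝 (1 / 2)) := by
  have hklFun : Tendsto klFun (𝓝[≠] 1) (𝓝 0) :=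
    tendsto_nhdsWithin_of_tendsto_nhds (continuous_klFun.tendsto' _ _ klFun_one)
  have hsq : Tendsto (fun x : ℝ => (x - 1) ^ 2) (𝓝[≠] 1) (𝓝 0) :=
    tendsto_nhdsWithin_of_tendsto_nhds (Continuous.tendsto' (by fun_prop) _ _ (by simp))
  have hlog : Tendsto (fun x => Real.log x / (2 * (x - 1))) (𝓝[≠] 1) (𝓝 (1 / 2)) := by
    have h := (hasDerivAt_iff_tendsto_slope.1 (Real.hasDerivAt_log one_ne_zero)).div_const 2
    rw [inv_one] at h
    refine h.congr fun x => ?_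
    rw [slope_def_field, Real.log_one, sub_zero, div_div, mul_comm]
  refine HasDerivAt.lhopital_zero_nhdsNE ?_ (.of_forall fun x => ?_) ?_ hklFun hsq hlog
  · filter_upwards [nhdsWithin_le_nhds (eventually_ne_nhds one_ne_zero)] with x hx
    exact hasDerivAt_klFun hx
  · simpa using ((hasDerivAt_id x).sub_const 1).fun_pow 2
  · filter_upwards [self_mem_nhdsWithin] with x hx
    exact mul_ne_zero two_ne_zero (sub_ne_zero.2 hx)

theorem klFun_sub_half_sq_isLittleO :
    (fun x => klFun x - (x - 1) ^ 2 / 2) =o[𝓝 1] fun x => (x - 1) ^ 2 := by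
  refine (isLittleO_iff_tendsto fun x hx => ?_).2 ?_
  · obtain rfl : x = 1 := by simpa [sub_eq_zero] using hx
    simp [klFun_one]
  · have h := tendsto_klFun_div_sq_sub_one.sub_const (1 / 2)
    rw [sub_self] at h
    suffices ContinuousAt (fun x => (klFun x - (x - 1) ^ 2 / 2) / (x - 1) ^ 2) 1 by
      simpa [ContinuousAt] using this
    refine continuousAt_iff_punctured_nhds.2 ((h.congr' ?_).trans (by simp))
    filter_upwards [self_mem_nhdsWithin] with x hx
    have : x - 1 ≠ 0 := sub_ne_zero.2 hx
    field_simp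

theorem tendsto_klFun_comp_div_sq {f : ℝ → ℝ} {f' : ℝ} (hf : HasDerivAt f f' 0) (h0 : f 0 = 1) :
    Tendsto (fun r => klFun (f r) / r ^ 2) (𝓝[≠] 0) (𝓝 (f' ^ 2 / 2)) := by
  have hslope : Tendsto (fun r => (f r - 1) / r) (𝓝[≠] 0) (𝓝 f') := by
    refine (hasDerivAt_iff_tendsto_slope.1 hf).congr fun r => ?_
    rw [slope_def_field, h0, sub_zero]
  have hlim : Tendsto f (𝓝[≠] 0) (𝓝 1) := h0 ▸ hf.continuousAt.tendsto.mono_left inf_le_left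
  have hO : (fun r => (f r - 1) ^ 2) =O[𝓝[≠] 0] fun r => r ^ 2 := by
    have h := hf.isBigO_sub.pow 2
    simp only [h0, sub_zero] at h
    exact h.mono nhdsWithin_le_nhds
  have hrem := ((klFun_sub_half_sq_isLittleO.comp_tendsto hlim).trans_isBigO
    hO).tendsto_div_nhds_zero
  have hsum := hrem.add ((hslope.pow 2).div_const 2)
  rw [zero_add] at hsum
  refine hsum.congr' ?_
  filter_upwards [self_mem_nhdsWithin] with r (hr : r ≠ 0)
  simp only [Function.comp_apply]
  field_simp
  ring

end KLFun

section Mixture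

variable {V : Type*} [NormedAddCommGroup V] [InnerProductSpace ℝ V] {ι : Type*} [Fintype ι]

/-- The likelihood ratio, with respect to standard Gaussian noise, of the sum of this noise and a
random signal that takes the value `a i` with probability `w i`. -/
def mixture (w : ι → ℝ) (a : ι → V) (z : V) : ℝ := ∑ i, w i * likelihood (a i) z

@[fun_prop]
theorem continuous_mixture (w : ι → ℝ) : Continuous fun p : (ι → V) × V => mixture w p.1 p.2 := by
  unfold mixture
  fun_prop

variable {w : ι → ℝ}

theorem mixture_zero (hw : w ∈ stdSimplex ℝ ι) (z : V) : mixture w 0 z = 1 := by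
  simp [mixture, likelihood, logLikelihood, hw.2]

theorem mixture_le_exp (hw : w ∈ stdSimplex ℝ ι) {a : ι → V} {z : V} {b : ℝ}
    (hb : ∀ i, logLikelihood (a i) z ≤ b) : mixture w a z ≤ Real.exp b :=
  calc mixture w a z ≤ ∑ i, w i * Real.exp b :=
        Finset.sum_le_sum fun i _ => mul_le_mul_of_nonneg_left (Real.exp_le_exp.2 (hb i)) (hw.1 i)
    _ = Real.exp b := by rw [← Finset.sum_mul, hw.2, one_mul]

theorem exp_le_mixture (hw : w ∈ stdSimplex ℝ ι) {a : ι → V} {z : V} {b : ℝ}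
    (hb : ∀ i, b ≤ logLikelihood (a i) z) : Real.exp b ≤ mixture w a z :=
  calc Real.exp b = ∑ i, w i * Real.exp b := by rw [← Finset.sum_mul, hw.2, one_mul]
    _ ≤ mixture w a z :=
        Finset.sum_le_sum fun i _ => mul_le_mul_of_nonneg_left (Real.exp_le_exp.2 (hb i)) (hw.1 i)

theorem abs_logLikelihood_le_sum (a : ι → V) (z : V) (i : ι) :
    |logLikelihood (a i) z| ≤ ∑ j, |logLikelihood (a j) z| :=
  Finset.single_le_sum (f := fun j => |logLikelihood (a j) z|) (fun _ _ => abs_nonneg _)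
    (Finset.mem_univ i)

theorem mixture_pos (hw : w ∈ stdSimplex ℝ ι) (a : ι → V) (z : V) : 0 < mixture w a z :=
  (Real.exp_pos _).trans_le
    (exp_le_mixture hw fun i => (abs_le.1 (abs_logLikelihood_le_sum a z i)).1)

theorem abs_log_mixture_le (hw : w ∈ stdSimplex ℝ ι) (a : ι → V) (z : V) :
    |Real.log (mixture w a z)| ≤ ∑ i, |logLikelihood (a i) z| := by
  have h i := abs_le.1 (abs_logLikelihood_le_sum a z i)
  rw [abs_le, Real.le_log_iff_exp_le (mixture_pos hw a z),
    Real.log_le_iff_le_exp (mixture_pos hw a z)]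
  exact ⟨exp_le_mixture hw fun i => (h i).1, mixture_le_exp hw fun i => (h i).2⟩

theorem abs_logLikelihood_add_le (a : ι → V) (i j : ι) (z : V) :
    |logLikelihood (a j) (a i + z)| ≤ ‖a‖ * ‖z‖ + 2 * ‖a‖ ^ 2 := by
  have hinner (y : V) : |inner ℝ y (a j)| ≤ ‖y‖ * ‖a‖ :=
    (abs_real_inner_le_norm _ _).trans (by gcongr; exact norm_le_pi_norm a j)
  have hnorm (i : ι) : ‖a i‖ * ‖a‖ ≤ ‖a‖ ^ 2 := by
    rw [sq]
    gcongr
    exact norm_le_pi_norm a i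
  have hsq : ‖a j‖ ^ 2 ≤ ‖a‖ ^ 2 := by
    gcongr
    exact norm_le_pi_norm a j
  have hi := abs_le.1 ((hinner (a i)).trans (hnorm i))
  have hz := abs_le.1 (hinner z)
  rw [logLikelihood, inner_add_left, abs_le]
  constructor <;> nlinarith [sq_nonneg ‖a j‖]

theorem abs_log_mixture_add_le (hw : w ∈ stdSimplex ℝ ι) (a : ι → V) (i : ι) (z : V) :
    |Real.log (mixture w a (a i + z))| ≤ Fintype.card ι * (‖a‖ * ‖z‖ + 2 * ‖a‖ ^ 2) := by
  refine (abs_log_mixture_le hw a _).trans ?_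
  exact (Finset.sum_le_sum fun j _ => abs_logLikelihood_add_le a i j z).trans_eq (by simp [mul_add])

theorem klFun_mixture_nonneg (hw : w ∈ stdSimplex ℝ ι) (a : ι → V) (z : V) :
    0 ≤ klFun (mixture w a z) := klFun_nonneg (mixture_pos hw a z).le

theorem abs_logLikelihood_smul_le {r : ℝ} (hr : |r| ≤ 1) {a : V} {A : ℝ} (hA : ‖a‖ ≤ A) (z : V) :
    |logLikelihood (r • a) z| ≤ |r| * (A * ‖z‖ + A ^ 2 / 2) := by
  have hinner : |inner ℝ z (r • a)| ≤ |r| * (A * ‖z‖) := by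
    rw [inner_smul_right, abs_mul, mul_comm A]
    gcongr
    exact (abs_real_inner_le_norm z a).trans (by gcongr)
  have hnorm : |‖r • a‖ ^ 2 / 2| ≤ |r| * (A ^ 2 / 2) := by
    have hsq : |r| ^ 2 ≤ |r| := pow_le_of_le_one (abs_nonneg r) hr two_ne_zero
    rw [abs_of_nonneg (by positivity), norm_smul, mul_pow, Real.norm_eq_abs, mul_div_assoc]
    gcongr
  rw [mul_add]
  exact (abs_sub _ _).trans (add_le_add hinner hnorm)

theorem abs_likelihood_smul_sub_one_le {r : ℝ} (hr : |r| ≤ 1) {a : V} {A : ℝ} (hA : ‖a‖ ≤ A)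
    (z : V) :
    |likelihood (r • a) z - 1| ≤ |r| * Real.exp (2 * (A * ‖z‖ + A ^ 2 / 2)) := by
  have hA0 : 0 ≤ A := (norm_nonneg a).trans hA
  set T := A * ‖z‖ + A ^ 2 / 2
  have hT0 : 0 ≤ T := by positivity
  have ht : |logLikelihood (r • a) z| ≤ |r| * T := abs_logLikelihood_smul_le hr hA z
  calc |likelihood (r • a) z - 1| ≤ _ := abs_exp_sub_one_le_mul_exp_abs _
    _ ≤ (|r| * T) * Real.exp T := by
        gcongr
        exact ht.trans (mul_le_of_le_one_left hT0 hr)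
    _ ≤ (|r| * Real.exp T) * Real.exp T := by
        gcongr
        linarith [Real.add_one_le_exp T]
    _ = |r| * Real.exp (2 * T) := by rw [mul_assoc, ← Real.exp_add, two_mul]

theorem abs_mixture_smul_sub_one_le (hw : w ∈ stdSimplex ℝ ι) (a : ι → V) {r : ℝ} (hr : |r| ≤ 1)
    (z : V) :
    |mixture w (r • a) z - 1| ≤ |r| * Real.exp (2 * (‖a‖ * ‖z‖ + ‖a‖ ^ 2 / 2)) := by
  have hsub : mixture w (r • a) z - 1 = ∑ i, w i * (likelihood (r • a i) z - 1) := by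
    simp [mixture, mul_sub, Finset.sum_sub_distrib, hw.2]
  rw [hsub]
  calc _ ≤ ∑ i, |w i * (likelihood (r • a i) z - 1)| := Finset.abs_sum_le_sum_abs _ _
    _ ≤ ∑ i, w i * (|r| * Real.exp (2 * (‖a‖ * ‖z‖ + ‖a‖ ^ 2 / 2))) :=
        Finset.sum_le_sum fun i _ => by
          rw [abs_mul, abs_of_nonneg (hw.1 i)]
          exact mul_le_mul_of_nonneg_left
            (abs_likelihood_smul_sub_one_le hr (norm_le_pi_norm a i) z) (hw.1 i)
    _ = _ := by rw [← Finset.sum_mul, hw.2, one_mul]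

theorem klFun_mixture_smul_le (hw : w ∈ stdSimplex ℝ ι) (a : ι → V) {r : ℝ} (hr : |r| ≤ 1)
    (z : V) :
    klFun (mixture w (r • a) z) ≤
      r ^ 2 * (Real.exp (2 * ‖a‖ ^ 2) * Real.exp (4 * ‖a‖ * ‖z‖)) :=
  calc _ ≤ |mixture w (r • a) z - 1| ^ 2 := by
        rw [sq_abs]
        exact klFun_le_sq_sub_one (mixture_pos hw _ z)
    _ ≤ (|r| * Real.exp (2 * (‖a‖ * ‖z‖ + ‖a‖ ^ 2 / 2))) ^ 2 := by
        gcongr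
        exact abs_mixture_smul_sub_one_le hw a hr z
    _ = _ := by
        rw [mul_pow, sq_abs, ← Real.exp_nat_mul, ← Real.exp_add]
        push_cast
        ring_nf

theorem hasDerivAt_mixture_smul (w : ι → ℝ) (a : ι → V) (z : V) :
    HasDerivAt (fun r : ℝ => mixture w (r • a) z) (inner ℝ z (∑ i, w i • a i)) 0 := by
  have hinner : inner ℝ z (∑ i, w i • a i) = ∑ i, w i * inner ℝ z (a i) := by
    simp only [inner_sum, inner_smul_right]
  rw [hinner]
  refine HasDerivAt.fun_sum fun i _ => HasDerivAt.const_mul (w i) ?_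
  have hlog : HasDerivAt (fun r : ℝ => logLikelihood (r • a i) z) (inner ℝ z (a i)) 0 := by
    have hlin := (hasDerivAt_id (0 : ℝ)).mul_const (inner ℝ z (a i))
    have hquad := (hasDerivAt_pow 2 (0 : ℝ)).mul_const (‖a i‖ ^ 2 / 2)
    simpa [logLikelihood, inner_smul_right, norm_smul, mul_pow, mul_div_assoc]
      using hlin.fun_sub hquad
  simpa [likelihood, logLikelihood] using hlog.exp

variable [FiniteDimensional ℝ V] [MeasurableSpace V]

/-- The relative entropy (in nats), with respect to standard Gaussian noise, of the sum of this
noise and a random signal that takes the value `a i` with probability `w i`. -/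
def mixtureKL (w : ι → ℝ) (a : ι → V) : ℝ := ∫ z, klFun (mixture w a z) ∂stdGaussian V

theorem mixtureKL_nonneg (hw : w ∈ stdSimplex ℝ ι) (a : ι → V) : 0 ≤ mixtureKL w a :=
  integral_nonneg (klFun_mixture_nonneg hw a)

variable [BorelSpace V]

theorem integrable_klFun_mixture (hw : w ∈ stdSimplex ℝ ι) (a : ι → V) :
    Integrable (fun z => klFun (mixture w a z)) (stdGaussian V) := by
  refine ((integrable_exp_mul_norm _ (4 * ‖a‖)).const_mul (Real.exp (2 * ‖a‖ ^ 2))).mono'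
    (continuous_klFun.comp (by fun_prop)).aestronglyMeasurable (.of_forall fun z => ?_)
  rw [Real.norm_of_nonneg (klFun_mixture_nonneg hw a z)]
  simpa using klFun_mixture_smul_le hw a (r := 1) (by simp) z

theorem mixtureKL_le (hw : w ∈ stdSimplex ℝ ι) (a : ι → V) :
    mixtureKL w a ≤ ∑ i, w i * (‖a i‖ ^ 2 / 2) := by
  have hint i := (integrable_klFun_likelihood (a i)).const_mul (w i)
  calc mixtureKL w a ≤ ∫ z, ∑ i, w i * klFun (likelihood (a i) z) ∂stdGaussian V :=
        integral_mono (integrable_klFun_mixture hw a) (integrable_finsetSum _ fun i _ => hint i)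
          fun z => convexOn_klFun.map_sum_le (fun i _ => hw.1 i) hw.2
            fun i _ => (likelihood_pos (a i) z).le
    _ = ∑ i, w i * (‖a i‖ ^ 2 / 2) := by
        rw [integral_finsetSum _ fun i _ => hint i]
        simp only [integral_const_mul, integral_klFun_likelihood]

theorem tendsto_mixtureKL_smul_div_sq (hw : w ∈ stdSimplex ℝ ι) (a : ι → V) :
    Tendsto (fun r : ℝ => mixtureKL w (r • a) / r ^ 2) (𝓝[≠] 0)
      (𝓝 (‖∑ i, w i • a i‖ ^ 2 / 2)) := by
  simp only [mixtureKL, ← integral_div, ← integral_sq_inner_stdGaussian]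
  refine tendsto_integral_filter_of_dominated_convergence
    (fun z => Real.exp (2 * ‖a‖ ^ 2) * Real.exp (4 * ‖a‖ * ‖z‖)) (.of_forall fun r => ?_) ?_
    ((integrable_exp_mul_norm _ _).const_mul _) (.of_forall fun z =>
      tendsto_klFun_comp_div_sq (hasDerivAt_mixture_smul w a z) (by simp [mixture_zero hw]))
  · exact ((integrable_klFun_mixture hw _).div_const _).aestronglyMeasurable
  · filter_upwards [self_mem_nhdsWithin, nhdsWithin_le_nhds
      (Metric.closedBall_mem_nhds (0 : ℝ) one_pos)] with r (hr0 : r ≠ 0) hr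
    refine .of_forall fun z => ?_
    rw [Real.norm_of_nonneg (div_nonneg (klFun_mixture_nonneg hw _ z) (sq_nonneg r)),
      div_le_iff₀' (by positivity)]
    exact klFun_mixture_smul_le hw a (by simpa using hr) z

theorem measurable_log_mixture_add (w : ι → ℝ) (i : ι) :
    Measurable fun p : (ι → V) × V => Real.log (mixture w p.1 (p.1 i + p.2)) :=
  Real.measurable_log.comp (Continuous.measurable (by fun_prop))

theorem sum_mul_integral_log_mixture_add (hw : w ∈ stdSimplex ℝ ι) (a : ι → V) :
    ∑ i, w i * ∫ z, Real.log (mixture w a (a i + z)) ∂stdGaussian V = mixtureKL w a := by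
  have hlog i : Integrable (fun z => likelihood (a i) z * Real.log (mixture w a z))
      (stdGaussian V) := by
    rw [← integrable_add_left_stdGaussian_iff]
    refine (((IsGaussian.integrable_id.norm.const_mul ‖a‖).add
      (integrable_const (2 * ‖a‖ ^ 2))).const_mul (Fintype.card ι : ℝ)).mono'
      ?_ (.of_forall (abs_log_mixture_add_le hw a i))
    exact ((measurable_log_mixture_add w i).comp measurable_prodMk_left).aestronglyMeasurable
  have hmix : Integrable (fun z => mixture w a z) (stdGaussian V) :=
    integrable_finsetSum _ fun i _ => (integrable_likelihood (a i)).const_mul _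
  have hmixlog : Integrable (fun z => mixture w a z * Real.log (mixture w a z))
      (stdGaussian V) := by
    simp only [mixture, Finset.sum_mul, mul_assoc]
    exact integrable_finsetSum _ fun i _ => (hlog i).const_mul _
  have hmass : ∫ z, mixture w a z ∂stdGaussian V = 1 := by
    simp only [mixture]
    rw [integral_finsetSum _ fun i _ => (integrable_likelihood (a i)).const_mul _]
    simp [integral_const_mul, integral_likelihood, hw.2]
  calc _ = ∑ i, w i * ∫ z, likelihood (a i) z * Real.log (mixture w a z) ∂stdGaussian V := by
        simp only [integral_add_left_stdGaussian (a _) fun z => Real.log (mixture w a z)]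
    _ = ∫ z, mixture w a z * Real.log (mixture w a z) ∂stdGaussian V := by
        simp only [← integral_const_mul]
        rw [← integral_finsetSum _ fun i _ => (hlog i).const_mul _]
        simp only [mixture, Finset.sum_mul, mul_assoc]
    _ = mixtureKL w a := by
        simp only [mixtureKL, klFun_apply, mul_comm (mixture w a _)] at hmixlog ⊢
        rw [integral_sub (by exact hmixlog.add (integrable_const 1)) hmix,
          integral_add hmixlog (integrable_const 1), hmass]
        simp

section RandomSignal

variable {Ω : Type*} [MeasurableSpace Ω] {ν : Measure Ω} {a : Ω → ι → V}

theorem integrable_log_mixture_add [IsFiniteMeasure ν] (hw : w ∈ stdSimplex ℝ ι)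
    (ha : MemLp a 2 ν) (i : ι) :
    Integrable (fun p : Ω × V => Real.log (mixture w (a p.1) (a p.1 i + p.2)))
      (ν.prod (stdGaussian V)) := by
  have hnorm := (ha.integrable one_le_two).norm.mul_prod
    (IsGaussian.integrable_id (μ := stdGaussian V)).norm
  have hsq := (ha.integrable_norm_pow two_ne_zero).comp_fst (stdGaussian V)
  refine ((hnorm.add (hsq.const_mul 2)).const_mul (Fintype.card ι : ℝ)).mono' ?_
    (.of_forall fun p => abs_log_mixture_add_le hw (a p.1) i p.2)
  exact ((measurable_log_mixture_add w i).comp_aemeasurable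
    (ha.1.comp_fst.aemeasurable.prodMk measurable_snd.aemeasurable)).aestronglyMeasurable

theorem sum_mul_integral_prod_log_mixture_add [IsFiniteMeasure ν] (hw : w ∈ stdSimplex ℝ ι)
    (ha : MemLp a 2 ν) :
    ∑ i, w i * ∫ p, Real.log (mixture w (a p.1) (a p.1 i + p.2)) ∂ν.prod (stdGaussian V) =
      ∫ ω, mixtureKL w (a ω) ∂ν := by
  have hint i := integrable_log_mixture_add hw ha i
  simp only [← integral_const_mul, ← sum_mul_integral_log_mixture_add hw]
  rw [integral_finsetSum _ fun i _ => ?_]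
  · simp only [integral_const_mul, integral_prod _ (hint _)]
  · simpa only [integral_const_mul] using (hint i).integral_prod_left.const_mul (w i)

theorem aestronglyMeasurable_mixtureKL (w : ι → ℝ) (ha : AEStronglyMeasurable a ν) :
    AEStronglyMeasurable (fun ω => mixtureKL w (a ω)) ν := by
  have hpair : AEStronglyMeasurable (fun p : Ω × V => (a p.1, p.2)) (ν.prod (stdGaussian V)) :=
    ha.comp_fst.prodMk continuous_id.aestronglyMeasurable.comp_snd
  exact ((continuous_klFun.comp (continuous_mixture w)).comp_aestronglyMeasurable
    hpair).integral_prod_right'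

theorem tendsto_integral_mixtureKL_smul_div_sq (hw : w ∈ stdSimplex ℝ ι) (ha : MemLp a 2 ν) :
    Tendsto (fun r : ℝ => (∫ ω, mixtureKL w (r • a ω) ∂ν) / r ^ 2) (𝓝[≠] 0)
      (𝓝 (∫ ω, ‖∑ i, w i • a ω i‖ ^ 2 / 2 ∂ν)) := by
  simp only [← integral_div]
  refine tendsto_integral_filter_of_dominated_convergence
    (fun ω => ∑ i, w i * (‖a ω i‖ ^ 2 / 2)) (.of_forall fun r => ?_) ?_ ?_
    (.of_forall fun ω => tendsto_mixtureKL_smul_div_sq hw (a ω))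
  · exact (aestronglyMeasurable_mixtureKL w (ha.1.const_smul r)).mul_const _
  · filter_upwards [self_mem_nhdsWithin] with r (hr : r ≠ 0)
    refine .of_forall fun ω => ?_
    rw [Real.norm_of_nonneg (div_nonneg (mixtureKL_nonneg hw _) (sq_nonneg r)),
      div_le_iff₀ (by positivity), Finset.sum_mul]
    refine (mixtureKL_le hw _).trans_eq (Finset.sum_congr rfl fun i _ => ?_)
    rw [Pi.smul_apply, norm_smul, mul_pow, Real.norm_eq_abs, sq_abs]
    ring
  · exact integrable_finsetSum _ fun i _ =>
      (((memLp_pi_iff.1 ha i).integrable_norm_pow two_ne_zero).div_const 2).const_mul _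

end RandomSignal

end Mixture

section Hadamard

variable {N : ℕ}

theorem hadamard_apply (h x : EuclideanSpace ℝ (Fin N)) (l : Fin N) :
    hadamard h x l = h l * x l := rfl

theorem hadamard_smul (h x : EuclideanSpace ℝ (Fin N)) (r : ℝ) :
    hadamard h (r • x) = r • hadamard h x := by
  ext l
  simp [hadamard_apply, mul_left_comm]

theorem hadamard_sum {ι : Type*} (s : Finset ι) (h : EuclideanSpace ℝ (Fin N))
    (x : ι → EuclideanSpace ℝ (Fin N)) : hadamard h (∑ i ∈ s, x i) = ∑ i ∈ s, hadamard h (x i) := by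
  ext l
  simp [hadamard_apply, Finset.mul_sum]

variable {ν : Measure (EuclideanSpace ℝ (Fin N))}

theorem memLp_hadamard {p : ℝ≥0∞} (hν : ∀ l, MemLp (fun h => h l) p ν)
    (x : EuclideanSpace ℝ (Fin N)) : MemLp (fun h => hadamard h x) p ν :=
  .of_eval_piLp fun l => (hν l).mul_const (x l)

theorem integral_norm_sq_hadamard (hν : ∀ l, MemLp (fun h => h l) 2 ν) {σ2 : ℝ}
    (hσ2 : ∀ l, ∫ h, h l ^ 2 ∂ν = σ2) (x : EuclideanSpace ℝ (Fin N)) :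
    ∫ h, ‖hadamard h x‖ ^ 2 ∂ν = σ2 * ‖x‖ ^ 2 := by
  simp only [EuclideanSpace.norm_sq_eq, hadamard_apply, Real.norm_eq_abs, sq_abs, mul_pow]
  rw [integral_finsetSum _ fun l _ => (hν l).integrable_sq.mul_const _]
  simp only [integral_mul_const, hσ2, Finset.mul_sum]

end Hadamard

theorem nbc_finFunctionFinEquiv {m : ℕ} (c : Fin m → Fin 2) (k : Fin m) :
    nbc (finFunctionFinEquiv c) k = c k :=
  congrFun (finFunctionFinEquiv.symm_apply_apply c) k

theorem norm_sq_sum_smul {V ι : Type*} [NormedAddCommGroup V] [InnerProductSpace ℝ V] [Fintype ι]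
    (w : ι → ℝ) (x : ι → V) :
    ‖∑ i, w i • x i‖ ^ 2 = ∑ i, ∑ j, w i * w j * inner ℝ (x i) (x j) := by
  simp only [← real_inner_self_eq_norm_sq, sum_inner, inner_sum, real_inner_smul_right,
    real_inner_comm]
  exact Finset.sum_congr rfl fun i _ => Finset.sum_congr rfl fun j _ => by ring

namespace Constellation

variable {m N : ℕ} (C : Constellation m N)

section BitStatistics

theorem bitProb_pos (k : Fin m) (u : Fin 2) : 0 < C.bitProb k u := by
  unfold bitProb
  split_ifs
  exacts [C.b_pos k, sub_pos.2 (C.b_lt_one k)]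

theorem sum_bitProb (k : Fin m) : ∑ u, C.bitProb k u = 1 := by
  simp [Fin.sum_univ_two, bitProb]

theorem bitProb_one_sub (k : Fin m) (u : Fin 2) : C.bitProb k (1 - u) = 1 - C.bitProb k u := by
  fin_cases u <;> simp [bitProb]

theorem symbolProb_finFunctionFinEquiv (c : Fin m → Fin 2) :
    C.symbolProb (finFunctionFinEquiv c) = ∏ k, C.bitProb k (c k) := by
  simp only [symbolProb, nbc_finFunctionFinEquiv]

theorem symbolProb_pos (i : Fin (2 ^ m)) : 0 < C.symbolProb i :=
  Finset.prod_pos fun k _ => C.bitProb_pos k _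

theorem symbolProb_mem_stdSimplex : C.symbolProb ∈ stdSimplex ℝ (Fin (2 ^ m)) := by
  refine ⟨fun i => (C.symbolProb_pos i).le, ?_⟩
  rw [← finFunctionFinEquiv.sum_comp]
  simp only [symbolProb_finFunctionFinEquiv]
  rw [← Fintype.prod_sum]
  simp only [sum_bitProb, Finset.prod_const_one]

theorem sum_symbolProb_of_nbc_eq (k : Fin m) (u : Fin 2) :
    ∑ i, (if nbc i k = u then C.symbolProb i else 0) = C.bitProb k u := by
  rw [← finFunctionFinEquiv.sum_comp]
  simp only [symbolProb_finFunctionFinEquiv, nbc_finFunctionFinEquiv]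
  have hprod (c : Fin m → Fin 2) : (if c k = u then ∏ l, C.bitProb l (c l) else 0) =
      ∏ l, (if l = k ∧ c l ≠ u then 0 else C.bitProb l (c l)) := by
    split_ifs with hc
    · exact Finset.prod_congr rfl fun l _ => (if_neg fun h => h.2 (h.1 ▸ hc)).symm
    · exact (Finset.prod_eq_zero (Finset.mem_univ k) (by simp [hc])).symm
  simp only [hprod]
  rw [← Fintype.prod_sum fun l v => if l = k ∧ v ≠ u then 0 else C.bitProb l v,
    Finset.prod_eq_single k _ (by simp)]
  · simp
  · intro l _ hl
    simp only [hl, false_and, if_false, sum_bitProb]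

/-- The conditional distribution of the symbol index given that bit `k` equals `u`. -/
def bitWeight (k : Fin m) (u : Fin 2) (i : Fin (2 ^ m)) : ℝ :=
  if nbc i k = u then C.symbolProb i / C.bitProb k u else 0

theorem bitProb_mul_bitWeight (k : Fin m) (u : Fin 2) (i : Fin (2 ^ m)) :
    C.bitProb k u * C.bitWeight k u i = if nbc i k = u then C.symbolProb i else 0 := by
  rw [bitWeight, mul_ite, mul_zero, mul_div_cancel₀ _ (C.bitProb_pos k u).ne']

theorem bitWeight_mem_stdSimplex (k : Fin m) (u : Fin 2) :
    C.bitWeight k u ∈ stdSimplex ℝ (Fin (2 ^ m)) := by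
  refine ⟨fun i => ?_, mul_left_cancel₀ (C.bitProb_pos k u).ne' ?_⟩
  · unfold bitWeight
    split_ifs
    exacts [div_nonneg (C.symbolProb_pos i).le (C.bitProb_pos k u).le, le_rfl]
  · simp only [Finset.mul_sum, bitProb_mul_bitWeight, sum_symbolProb_of_nbc_eq, mul_one]

theorem sum_symbolProb_mul_nbc (k : Fin m) (f : Fin 2 → Fin (2 ^ m) → ℝ) :
    ∑ i, C.symbolProb i * f (nbc i k) i =
      ∑ u, C.bitProb k u * ∑ i, C.bitWeight k u i * f u i := by
  simp only [Finset.mul_sum, ← mul_assoc, bitProb_mul_bitWeight, ite_mul, zero_mul]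
  rw [Finset.sum_comm]
  simp only [Finset.sum_ite_eq, Finset.mem_univ, if_true]

theorem ite_inv_bitProb_sub_one (k : Fin m) (u v : Fin 2) :
    (if u = v then (C.bitProb k v)⁻¹ else 0) - 1 =
      (-1) ^ ((u : ℕ) + (v : ℕ)) * (C.bitProb k (1 - u) / C.bitProb k v) := by
  have hv := (C.bitProb_pos k v).ne'
  split_ifs with huv
  · rw [huv, Even.neg_one_pow ⟨_, rfl⟩, bitProb_one_sub]
    field_simp
  · have hne : ∀ u v : Fin 2, u ≠ v → 1 - u = v ∧ Odd ((u : ℕ) + (v : ℕ)) := by decide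
    obtain ⟨hu, hodd⟩ := hne u v huv
    rw [hu, hodd.neg_one_pow, div_self hv]
    norm_num

theorem sum_bitProb_mul_bitWeight_mul_bitWeight_sub (k : Fin m) (i j : Fin (2 ^ m)) :
    ∑ u, C.bitProb k u * (C.bitWeight k u i * C.bitWeight k u j) -
        C.symbolProb i * C.symbolProb j =
      C.symbolProb i * C.symbolProb j * ((-1) ^ ((nbc i k : ℕ) + (nbc j k : ℕ)) *
        (C.bitProb k (1 - nbc i k) / C.bitProb k (nbc j k))) := by
  have hsum : ∑ u, C.bitProb k u * (C.bitWeight k u i * C.bitWeight k u j) =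
      C.symbolProb i * C.bitWeight k (nbc i k) j := by
    simp only [← mul_assoc, bitProb_mul_bitWeight, ite_mul, zero_mul, Finset.sum_ite_eq,
      Finset.mem_univ, if_true]
  rw [hsum, ← ite_inv_bitProb_sub_one, bitWeight]
  simp only [eq_comm (a := nbc j k)]
  split_ifs with h
  · rw [h]
    ring
  · ring

theorem sum_bitProb_mul_norm_sq_sub (k : Fin m) :
    ∑ u, C.bitProb k u * ‖∑ i, C.bitWeight k u i • C.x i‖ ^ 2 -
        ‖∑ i, C.symbolProb i • C.x i‖ ^ 2 =
      ∑ i, ∑ j, C.symbolProb i * C.symbolProb j * inner ℝ (C.x i) (C.x j) *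
        ((-1) ^ ((nbc i k : ℕ) + (nbc j k : ℕ)) *
          (C.bitProb k (1 - nbc i k) / C.bitProb k (nbc j k))) := by
  have hkernel i j := C.sum_bitProb_mul_bitWeight_mul_bitWeight_sub k i j
  simp only [norm_sq_sum_smul, Finset.mul_sum]
  rw [Finset.sum_comm, ← Finset.sum_sub_distrib]
  refine Finset.sum_congr rfl fun i _ => ?_
  rw [Finset.sum_comm, ← Finset.sum_sub_distrib]
  refine Finset.sum_congr rfl fun j _ => ?_
  rw [mul_right_comm (_ * _), ← hkernel i j, sub_mul, Finset.sum_mul]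
  simp only [mul_assoc]

theorem sum_sum_bitProb_mul_norm_sq_sub :
    ∑ k, (∑ u, C.bitProb k u * ‖∑ i, C.bitWeight k u i • C.x i‖ ^ 2 -
        ‖∑ i, C.symbolProb i • C.x i‖ ^ 2) =
      ∑ i, C.symbolProb i * ∑ j, C.symbolProb j * inner ℝ (C.x i) (C.x j) *
        ∑ k, (-1) ^ ((nbc i k : ℕ) + (nbc j k : ℕ)) *
          (C.bitProb k (1 - nbc i k) / C.bitProb k (nbc j k)) := by
  simp only [C.sum_bitProb_mul_norm_sq_sub, Finset.mul_sum, ← mul_assoc]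
  rw [Finset.sum_comm]
  exact Finset.sum_congr rfl fun i _ => Finset.sum_comm

end BitStatistics

section BitsLaw

instance isProbabilityMeasure_bitLaw (k : Fin m) : IsProbabilityMeasure
    (∑ u : Fin 2, ENNReal.ofReal (C.bitProb k u) • Measure.dirac u) := by
  constructor
  simp only [Measure.coe_finsetSum, Measure.smul_apply, Finset.sum_apply, measure_univ,
    smul_eq_mul, mul_one]
  rw [← ENNReal.ofReal_sum_of_nonneg fun u _ => (C.bitProb_pos k u).le, sum_bitProb,
    ENNReal.ofReal_one]

instance isProbabilityMeasure_bitsLaw : IsProbabilityMeasure C.bitsLaw := by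
  unfold bitsLaw
  infer_instance

theorem bitsLaw_real_singleton (c : Fin m → Fin 2) :
    C.bitsLaw.real {c} = C.symbolProb (finFunctionFinEquiv c) := by
  rw [Measure.real, bitsLaw, Measure.pi_singleton, symbolProb_finFunctionFinEquiv,
    ENNReal.toReal_prod]
  refine Finset.prod_congr rfl fun k _ => ?_
  simp only [Measure.coe_finsetSum, Finset.sum_apply, Measure.smul_apply, smul_eq_mul,
    Measure.dirac_apply' _ (MeasurableSet.singleton _), indicator_apply,
    mem_singleton_iff, Pi.one_apply, mul_ite, mul_one, mul_zero, Finset.sum_ite_eq',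
    Finset.mem_univ, if_true]
  exact ENNReal.toReal_ofReal (C.bitProb_pos k _).le

theorem integral_bitsLaw {F : Type*} [NormedAddCommGroup F] [NormedSpace ℝ F] [CompleteSpace F]
    (f : (Fin m → Fin 2) → F) :
    ∫ c, f c ∂C.bitsLaw = ∑ i, C.symbolProb i • f (finFunctionFinEquiv.symm i) := by
  rw [integral_fintype .of_finite, ← finFunctionFinEquiv.sum_comp]
  simp only [bitsLaw_real_singleton, Equiv.symm_apply_apply]

theorem mean_eq : C.mean = ∑ i, C.symbolProb i • C.x i := by
  simp only [mean, symbol, integral_bitsLaw, Equiv.apply_symm_apply]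

theorem energy_eq : C.energy = ∑ i, C.symbolProb i * ‖C.x i‖ ^ 2 := by
  simp only [energy, symbol, integral_bitsLaw, Equiv.apply_symm_apply, smul_eq_mul]

variable {C} in
theorem energy_pos (hC : ∃ i, C.x i ≠ 0) : 0 < C.energy := by
  obtain ⟨i, hi⟩ := hC
  rw [energy_eq]
  refine Finset.sum_pos' (fun j _ => mul_nonneg (C.symbolProb_pos j).le (sq_nonneg _))
    ⟨i, Finset.mem_univ i, mul_pos (C.symbolProb_pos i) ?_⟩
  have := norm_pos_iff.2 hi
  positivity

theorem scale_scale (r s : ℝ) : (C.scale r).scale s = C.scale (s * r) := by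
  simp only [scale, smul_smul]

theorem energy_scale (r : ℝ) : (C.scale r).energy = r ^ 2 * C.energy := by
  simp only [energy, symbol, bitsLaw, scale, norm_smul, mul_pow, Real.norm_eq_abs, sq_abs,
    integral_const_mul]
  rfl

end BitsLaw

end Constellation

section Channel

variable {m N : ℕ} (C : Constellation m N)

/-- The received symbols under the fading vector `h`, before the noise of level `N₀` is added, in
units of the standard deviation `√(N₀ / 2)` of the noise. -/
def Constellation.faded (N₀ : ℝ) (h : EuclideanSpace ℝ (Fin N)) (i : Fin (2 ^ m)) :
    EuclideanSpace ℝ (Fin N) :=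
  (√(N₀ / 2))⁻¹ • hadamard h (C.x i)

theorem Constellation.faded_scale (r N₀ : ℝ) (h : EuclideanSpace ℝ (Fin N)) :
    (C.scale r).faded N₀ h = r • C.faded N₀ h := by
  ext1 i
  simp only [faded, scale, hadamard_smul, Pi.smul_apply, smul_comm r]

theorem Constellation.faded_eq_scale_one {N₀ : ℝ} (hN₀ : 0 ≤ N₀) (h : EuclideanSpace ℝ (Fin N)) :
    C.faded N₀ h = (C.scale (√N₀)⁻¹).faded 1 h := by
  ext1 i
  rw [faded_scale, Pi.smul_apply, faded, faded, smul_smul, ← mul_inv, ← Real.sqrt_mul hN₀,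
    mul_one_div]

theorem channelPdf_sqrt_smul {N₀ : ℝ} (hN₀ : 0 < N₀) (i : Fin (2 ^ m))
    (y h : EuclideanSpace ℝ (Fin N)) :
    channelPdf N₀ (√(N₀ / 2) • y) (C.x i) h =
      1 / (N₀ * π) ^ ((N : ℝ) / 2) * Real.exp (-‖y‖ ^ 2 / 2) * likelihood (C.faded N₀ h i) y := by
  have hc : 0 < √(N₀ / 2) := by positivity
  have hsub : √(N₀ / 2) • y - hadamard h (C.x i) = √(N₀ / 2) • (y - C.faded N₀ h i) := by
    rw [Constellation.faded, smul_sub, smul_inv_smul₀ hc.ne']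
  rw [channelPdf, hsub, mul_assoc, ← exp_neg_sq_norm_sub, norm_smul, Real.norm_of_nonneg hc.le,
    mul_pow, Real.sq_sqrt (by positivity)]
  field_simp

theorem outputPdf_sqrt_smul {N₀ : ℝ} (hN₀ : 0 < N₀) (y h : EuclideanSpace ℝ (Fin N)) :
    outputPdf C N₀ (√(N₀ / 2) • y) h =
      1 / (N₀ * π) ^ ((N : ℝ) / 2) * Real.exp (-‖y‖ ^ 2 / 2) *
        mixture C.symbolProb (C.faded N₀ h) y := by
  simp only [outputPdf, mixture, channelPdf_sqrt_smul C hN₀, Finset.mul_sum, mul_left_comm]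

theorem bitOutputPdf_sqrt_smul {N₀ : ℝ} (hN₀ : 0 < N₀) (k : Fin m)
    (y h : EuclideanSpace ℝ (Fin N)) (u : Fin 2) :
    bitOutputPdf C N₀ k (√(N₀ / 2) • y) h u =
      1 / (N₀ * π) ^ ((N : ℝ) / 2) * Real.exp (-‖y‖ ^ 2 / 2) *
        mixture (C.bitWeight k u) (C.faded N₀ h) y := by
  simp only [bitOutputPdf, mixture, channelPdf_sqrt_smul C hN₀, Finset.mul_sum, mul_left_comm,
    Constellation.bitWeight, Finset.sum_filter, ite_mul, zero_mul, mul_ite, mul_zero]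

theorem infoDensity_sqrt_smul {N₀ : ℝ} (hN₀ : 0 < N₀) (k : Fin m) (c : Fin m → Fin 2)
    (h z : EuclideanSpace ℝ (Fin N)) :
    infoDensity C N₀ k (c, h, √(N₀ / 2) • z) =
      (Real.log (mixture (C.bitWeight k (c k)) (C.faded N₀ h)
          (C.faded N₀ h (finFunctionFinEquiv c) + z)) -
        Real.log (mixture C.symbolProb (C.faded N₀ h)
          (C.faded N₀ h (finFunctionFinEquiv c) + z))) / Real.log 2 := by
  have hreceived : received C (c, h, √(N₀ / 2) • z) =
      √(N₀ / 2) • (C.faded N₀ h (finFunctionFinEquiv c) + z) := by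
    have hc : √(N₀ / 2) ≠ 0 := by positivity
    rw [received, Constellation.symbol, Constellation.faded, smul_add, smul_inv_smul₀ hc]
  have hK (y : EuclideanSpace ℝ (Fin N)) :
      1 / (N₀ * π) ^ ((N : ℝ) / 2) * Real.exp (-‖y‖ ^ 2 / 2) ≠ 0 := by positivity
  rw [infoDensity, hreceived, bitOutputPdf_sqrt_smul C hN₀, outputPdf_sqrt_smul C hN₀,
    mul_div_mul_left _ _ (hK _), Real.logb,
    Real.log_div (mixture_pos (C.bitWeight_mem_stdSimplex k _) _ _).ne'
      (mixture_pos C.symbolProb_mem_stdSimplex _ _).ne']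

theorem noiseLaw_eq_map_stdGaussian {N₀ : ℝ} (hN₀ : 0 < N₀) :
    noiseLaw N N₀ = (stdGaussian (EuclideanSpace ℝ (Fin N))).map (√(N₀ / 2) • ·) := by
  rw [map_sqrt_smul_stdGaussian (by positivity), noiseLaw, finrank_euclideanSpace_fin,
    mul_div_cancel₀ N₀ two_ne_zero, show 2 * π * (N₀ / 2) = N₀ * π by ring]

theorem isProbabilityMeasure_noiseLaw {N₀ : ℝ} (hN₀ : 0 < N₀) :
    IsProbabilityMeasure (noiseLaw N N₀) := by
  rw [noiseLaw_eq_map_stdGaussian hN₀]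
  exact Measure.isProbabilityMeasure_map (by fun_prop)

theorem continuous_channelPdf_received (N₀ : ℝ) (c : Fin m → Fin 2) (i : Fin (2 ^ m)) :
    Continuous fun p => channelPdf N₀ (received C (c, p)) (C.x i) p.1 := by
  unfold channelPdf received hadamard
  fun_prop

theorem measurable_infoDensity (N₀ : ℝ) (k : Fin m) : Measurable (infoDensity C N₀ k) := by
  refine measurable_from_prod_countable_right fun c => ?_
  have hout : Measurable fun p => outputPdf C N₀ (received C (c, p)) p.1 :=
    Finset.measurable_fun_sum _ fun i _ =>
      (continuous_channelPdf_received C N₀ c i).measurable.const_mul _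
  have hbit : Measurable fun p => bitOutputPdf C N₀ k (received C (c, p)) p.1 (c k) :=
    Finset.measurable_fun_sum _ fun i _ =>
      (continuous_channelPdf_received C N₀ c i).measurable.const_mul _
  exact (hbit.div hout).log.div_const _

variable {ν : Measure (EuclideanSpace ℝ (Fin N))}

theorem prod_noiseLaw [SFinite ν] {N₀ : ℝ} (hN₀ : 0 < N₀) :
    ν.prod (noiseLaw N N₀) =
      (ν.prod (stdGaussian (EuclideanSpace ℝ (Fin N)))).map (Prod.map id (√(N₀ / 2) • ·)) := by
  rw [noiseLaw_eq_map_stdGaussian hN₀, ← Measure.map_prod_map _ _ measurable_id (by fun_prop),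
    Measure.map_id]

theorem memLp_faded (hν : ∀ l, MemLp (fun h => h l) 2 ν) (N₀ : ℝ) : MemLp (C.faded N₀) 2 ν :=
  memLp_pi_iff.2 fun i => (memLp_hadamard hν (C.x i)).const_smul (√(N₀ / 2))⁻¹

theorem integral_norm_sq_sum_faded (hν : ∀ l, MemLp (fun h => h l) 2 ν) {σ2 : ℝ}
    (hσ2 : ∀ l, ∫ h, h l ^ 2 ∂ν = σ2) (w : Fin (2 ^ m) → ℝ) {N₀ : ℝ} (hN₀ : 0 ≤ N₀) :
    ∫ h, ‖∑ i, w i • C.faded N₀ h i‖ ^ 2 / 2 ∂ν = σ2 / N₀ * ‖∑ i, w i • C.x i‖ ^ 2 := by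
  have hfaded h : ∑ i, w i • C.faded N₀ h i = (√(N₀ / 2))⁻¹ • hadamard h (∑ i, w i • C.x i) := by
    simp only [hadamard_sum, hadamard_smul, Finset.smul_sum, Constellation.faded, smul_comm (w _)]
  simp only [hfaded, norm_smul, mul_pow, norm_inv, inv_pow, Real.norm_eq_abs, sq_abs,
    Real.sq_sqrt (div_nonneg hN₀ zero_le_two)]
  rw [integral_div, integral_const_mul, integral_norm_sq_hadamard hν hσ2]
  field_simp

variable [IsFiniteMeasure ν]

theorem integrable_infoDensity_prodMk (hν : ∀ l, MemLp (fun h => h l) 2 ν) {N₀ : ℝ}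
    (hN₀ : 0 < N₀) (k : Fin m) (c : Fin m → Fin 2) :
    Integrable (fun p => infoDensity C N₀ k (c, p)) (ν.prod (noiseLaw N N₀)) := by
  have hlog {w : Fin (2 ^ m) → ℝ} (hw : w ∈ stdSimplex ℝ (Fin (2 ^ m))) :=
    integrable_log_mixture_add hw (memLp_faded C hν N₀) (finFunctionFinEquiv c)
  have hmeas : Measurable fun p => infoDensity C N₀ k (c, p) :=
    (measurable_infoDensity C N₀ k).comp measurable_prodMk_left
  rw [prod_noiseLaw hN₀, integrable_map_measure hmeas.aestronglyMeasurable (by fun_prop)]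
  exact (((hlog (C.bitWeight_mem_stdSimplex k (c k))).sub
    (hlog C.symbolProb_mem_stdSimplex)).div_const (Real.log 2)).congr
      (.of_forall fun p => (infoDensity_sqrt_smul C hN₀ k c p.1 p.2).symm)

theorem integrable_infoDensity (hν : ∀ l, MemLp (fun h => h l) 2 ν) {N₀ : ℝ} (hN₀ : 0 < N₀)
    (k : Fin m) : Integrable (infoDensity C N₀ k) (jointLaw C ν N₀) := by
  have := isProbabilityMeasure_noiseLaw (N := N) hN₀
  exact (integrable_prod_iff (measurable_infoDensity C N₀ k).aestronglyMeasurable).2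
    ⟨.of_forall fun c => integrable_infoDensity_prodMk C hν hN₀ k c, .of_finite⟩

theorem integral_infoDensity_prodMk (hν : ∀ l, MemLp (fun h => h l) 2 ν) {N₀ : ℝ}
    (hN₀ : 0 < N₀) (k : Fin m) (c : Fin m → Fin 2) :
    ∫ p, infoDensity C N₀ k (c, p) ∂ν.prod (noiseLaw N N₀) =
      (∫ p, Real.log (mixture (C.bitWeight k (c k)) (C.faded N₀ p.1)
          (C.faded N₀ p.1 (finFunctionFinEquiv c) + p.2))
            ∂ν.prod (stdGaussian (EuclideanSpace ℝ (Fin N))) -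
        ∫ p, Real.log (mixture C.symbolProb (C.faded N₀ p.1)
          (C.faded N₀ p.1 (finFunctionFinEquiv c) + p.2))
            ∂ν.prod (stdGaussian (EuclideanSpace ℝ (Fin N)))) / Real.log 2 := by
  have hlog {w : Fin (2 ^ m) → ℝ} (hw : w ∈ stdSimplex ℝ (Fin (2 ^ m))) :=
    integrable_log_mixture_add hw (memLp_faded C hν N₀) (finFunctionFinEquiv c)
  have hmeas : Measurable fun p => infoDensity C N₀ k (c, p) :=
    (measurable_infoDensity C N₀ k).comp measurable_prodMk_left
  rw [prod_noiseLaw hN₀, integral_map (by fun_prop) hmeas.aestronglyMeasurable,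
    ← integral_sub (hlog (C.bitWeight_mem_stdSimplex k (c k))) (hlog C.symbolProb_mem_stdSimplex),
    ← integral_div]
  exact integral_congr_ae (.of_forall fun p => infoDensity_sqrt_smul C hN₀ k c p.1 p.2)

theorem bitMI_eq (hν : ∀ l, MemLp (fun h => h l) 2 ν) {N₀ : ℝ} (hN₀ : 0 < N₀) (k : Fin m) :
    bitMI C ν N₀ k =
      (∑ u, C.bitProb k u * ∫ h, mixtureKL (C.bitWeight k u) (C.faded N₀ h) ∂ν -
        ∫ h, mixtureKL C.symbolProb (C.faded N₀ h) ∂ν) / Real.log 2 := by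
  have hfaded := memLp_faded C hν N₀
  have := isProbabilityMeasure_noiseLaw (N := N) hN₀
  have hnbc (i : Fin (2 ^ m)) : (finFunctionFinEquiv.symm i : Fin m → Fin 2) k = nbc i k := rfl
  rw [bitMI, jointLaw, integral_prod _ (integrable_infoDensity C hν hN₀ k), C.integral_bitsLaw]
  simp only [integral_infoDensity_prodMk C hν hN₀, hnbc, Equiv.apply_symm_apply, smul_eq_mul,
    ← mul_div_assoc, mul_sub, ← Finset.sum_div, Finset.sum_sub_distrib]
  rw [C.sum_symbolProb_mul_nbc k fun u i => ∫ p, Real.log (mixture (C.bitWeight k u)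
      (C.faded N₀ p.1) (C.faded N₀ p.1 i + p.2)) ∂ν.prod (stdGaussian (EuclideanSpace ℝ (Fin N))),
    sum_mul_integral_prod_log_mixture_add C.symbolProb_mem_stdSimplex hfaded]
  simp only [sum_mul_integral_prod_log_mixture_add (C.bitWeight_mem_stdSimplex k _) hfaded]

end Channel

theorem hasDerivWithinAt_comp_sqrt_div {G : ℝ → ℝ} {L K : ℝ} (hG0 : G 0 = 0)
    (hG : Tendsto (fun r => G r / r ^ 2) (𝓝[≠] 0) (𝓝 L)) (hK : 0 < K) :
    HasDerivWithinAt (fun s => G √(s / K)) (L / K) (Ici 0) 0 := by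
  have hsqrt : Tendsto (fun s => √(s / K)) (𝓝[>] 0) (𝓝[≠] 0) := by
    refine tendsto_nhdsWithin_iff.2 ⟨?_, ?_⟩
    · have hcont : Continuous fun s => √(s / K) := by fun_prop
      simpa using (hcont.tendsto 0).mono_left nhdsWithin_le_nhds
    · filter_upwards [self_mem_nhdsWithin] with s (hs : 0 < s)
      exact (Real.sqrt_pos.2 (by positivity)).ne'
  rw [hasDerivWithinAt_iff_tendsto_slope, Ici_sdiff_left]
  refine ((hG.comp hsqrt).div_const K).congr' ?_
  filter_upwards [self_mem_nhdsWithin] with s (hs : 0 < s)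
  rw [slope_def_field, Function.comp_apply, Real.sq_sqrt (by positivity), zero_div, Real.sqrt_zero,
    hG0, sub_zero, sub_zero, div_div, div_mul_cancel₀ _ hK.ne']

section SNR

variable {m N : ℕ} (C : Constellation m N) {ν : Measure (EuclideanSpace ℝ (Fin N))}
  [IsFiniteMeasure ν]

theorem bicmGMI_eq_scale_one (hν : ∀ l, MemLp (fun h => h l) 2 ν) {N₀ : ℝ} (hN₀ : 0 < N₀) :
    bicmGMI C ν N₀ = bicmGMI (C.scale (√N₀)⁻¹) ν 1 := by
  refine Finset.sum_congr rfl fun k _ => ?_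
  rw [bitMI_eq C hν hN₀, bitMI_eq _ hν one_pos]
  simp only [C.faded_eq_scale_one hN₀.le]
  rfl

theorem bitMI_scale_zero (hν : ∀ l, MemLp (fun h => h l) 2 ν) {N₀ : ℝ} (hN₀ : 0 < N₀)
    (k : Fin m) : bitMI (C.scale 0) ν N₀ k = 0 := by
  have hzero {w : Fin (2 ^ m) → ℝ} (hw : w ∈ stdSimplex ℝ (Fin (2 ^ m))) :
      mixtureKL w (0 : Fin (2 ^ m) → EuclideanSpace ℝ (Fin N)) = 0 := by
    simp only [mixtureKL, mixture_zero hw, klFun_one, integral_zero]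
  rw [bitMI_eq _ hν hN₀]
  simp [C.faded_scale, hzero (Constellation.bitWeight_mem_stdSimplex _ k _),
    hzero (Constellation.symbolProb_mem_stdSimplex _)]

theorem tendsto_bitMI_scale_div_sq (hν : ∀ l, MemLp (fun h => h l) 2 ν) {σ2 : ℝ}
    (hσ2 : ∀ l, ∫ h, h l ^ 2 ∂ν = σ2) {N₀ : ℝ} (hN₀ : 0 < N₀) (k : Fin m) :
    Tendsto (fun r => bitMI (C.scale r) ν N₀ k / r ^ 2) (𝓝[≠] 0)
      (𝓝 (σ2 / N₀ * (∑ u, C.bitProb k u * ‖∑ i, C.bitWeight k u i • C.x i‖ ^ 2 -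
        ‖∑ i, C.symbolProb i • C.x i‖ ^ 2) / Real.log 2)) := by
  have hlim {w : Fin (2 ^ m) → ℝ} (hw : w ∈ stdSimplex ℝ (Fin (2 ^ m))) :=
    integral_norm_sq_sum_faded C hν hσ2 w hN₀.le ▸
      tendsto_integral_mixtureKL_smul_div_sq hw (memLp_faded C hν N₀)
  have hbit := tendsto_finsetSum Finset.univ fun u _ =>
    (hlim (C.bitWeight_mem_stdSimplex k u)).const_mul (C.bitProb k u)
  convert (hbit.sub (hlim C.symbolProb_mem_stdSimplex)).div_const (Real.log 2) using 2 with r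
  · rw [bitMI_eq _ hν hN₀, div_right_comm, sub_div, Finset.sum_div]
    simp only [C.faded_scale, mul_div_assoc]
    rfl
  · simp only [mul_sub, Finset.mul_sum, mul_left_comm]

variable {pH : Measure ℝ}

theorem bicmGMI_scale_eq_gmiOfSNR (hν : ∀ l, MemLp (fun h => h l) 2 ν) (hC : C.energy ≠ 0)
    (hpH : secondMoment pH ≠ 0) {r : ℝ} (hr : 0 ≤ r) {N₀ : ℝ} (hN₀ : 0 < N₀) :
    bicmGMI (C.scale r) ν N₀ = gmiOfSNR C ν pH (snr (C.scale r) pH N₀) := by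
  have hscale : √(snr (C.scale r) pH N₀ / (secondMoment pH * C.energy)) = (√N₀)⁻¹ * r := by
    rw [snr, C.energy_scale, ← Real.sqrt_inv, ← Real.sqrt_sq hr, ← Real.sqrt_mul (by positivity),
      Real.sqrt_sq hr]
    congr 1
    field_simp
  rw [bicmGMI_eq_scale_one _ hν hN₀, C.scale_scale, gmiOfSNR, hscale]

theorem hasDerivWithinAt_gmiOfSNR (hν : ∀ l, MemLp (fun h => h l) 2 ν)
    (hσ2 : ∀ l, ∫ h, h l ^ 2 ∂ν = secondMoment pH) (hC : 0 < C.energy)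
    (hpH : 0 < secondMoment pH) :
    HasDerivWithinAt (gmiOfSNR C ν pH)
      (Real.logb 2 (Real.exp 1) / C.energy *
        ∑ k, (∑ u, C.bitProb k u * ‖∑ i, C.bitWeight k u i • C.x i‖ ^ 2 -
          ‖∑ i, C.symbolProb i • C.x i‖ ^ 2)) (Ici 0) 0 := by
  have hlim : Tendsto (fun r => bicmGMI (C.scale r) ν 1 / r ^ 2) (𝓝[≠] 0)
      (𝓝 (∑ k, secondMoment pH / 1 * (∑ u, C.bitProb k u * ‖∑ i, C.bitWeight k u i • C.x i‖ ^ 2 -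
        ‖∑ i, C.symbolProb i • C.x i‖ ^ 2) / Real.log 2)) := by
    simpa only [bicmGMI, Finset.sum_div] using tendsto_finsetSum Finset.univ fun k _ =>
      tendsto_bitMI_scale_div_sq C hν hσ2 one_pos k
  convert hasDerivWithinAt_comp_sqrt_div (G := fun r => bicmGMI (C.scale r) ν 1)
    (Finset.sum_eq_zero fun k _ => bitMI_scale_zero C hν one_pos k) hlim (mul_pos hpH hC) using 1
  · rfl
  · rw [← Finset.sum_div, ← Finset.mul_sum, Real.logb, Real.log_exp]
    field_simp

end SNR

end BICM

end

open BICM in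
theorem theorem5_general {m N : ℕ} (C : Constellation m N) (hC : ∃ i, C.x i ≠ 0)
    (ν : Measure (EuclideanSpace ℝ (Fin N))) [IsFiniteMeasure ν] (pH : Measure ℝ)
    (hν : ∀ l, ∫ h, h l ^ 2 ∂ν = secondMoment pH) (hH0 : 0 < secondMoment pH) :
    C.mean = ∑ i, C.symbolProb i • C.x i ∧
    C.energy = ∑ i, C.symbolProb i * ‖C.x i‖ ^ 2 ∧
    (∀ r N₀ : ℝ, 0 < N₀ → ∀ k,
      Integrable (infoDensity (C.scale r) N₀ k) (jointLaw (C.scale r) ν N₀)) ∧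
    (∀ r : ℝ, 0 ≤ r → ∀ N₀ : ℝ, 0 < N₀ →
      bicmGMI (C.scale r) ν N₀ = gmiOfSNR C ν pH (snr (C.scale r) pH N₀)) ∧
    HasDerivWithinAt (gmiOfSNR C ν pH)
      (Real.logb 2 (Real.exp 1) / C.energy *
        ∑ i, C.symbolProb i * ∑ j, C.symbolProb j * inner ℝ (C.x i) (C.x j) *
          ∑ k, (-1) ^ ((nbc i k : ℕ) + (nbc j k : ℕ)) *
            (C.bitProb k (1 - nbc i k) / C.bitProb k (nbc j k)))
      (Set.Ici 0) 0 := by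
  have hE : 0 < C.energy := Constellation.energy_pos hC
  have hLp (l : Fin N) : MemLp (fun h => h l) 2 ν :=
    (memLp_two_iff_integrable_sq (by fun_prop)).2
      (.of_integral_ne_zero ((hν l).trans_ne hH0.ne'))
  refine ⟨C.mean_eq, C.energy_eq, fun r N₀ hN₀ k => integrable_infoDensity _ hLp hN₀ k,
    fun r hr N₀ hN₀ => bicmGMI_scale_eq_gmiOfSNR C hLp hE.ne' hH0.ne' hr hN₀, ?_⟩
  rw [← C.sum_sum_bitProb_mul_norm_sq_sub]
  exact hasDerivWithinAt_gmiOfSNR C hLp hν hE hH0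

theorem theorem5 {m N : ℕ} (C : BICM.Constellation m N)
    -- some symbol is nonzero, that is, the symbol energy is positive
    (hC : ∃ i, C.x i ≠ 0)
    -- the law of the fading vector, whose coordinates all have the law `pH`
    (ν : MeasureTheory.Measure (EuclideanSpace ℝ (Fin N)))
    [MeasureTheory.IsProbabilityMeasure ν] (pH : MeasureTheory.Measure ℝ)
    (hν : ∀ l, ν.map (fun h => h l) = pH)
    (hH : MeasureTheory.Integrable (fun t : ℝ => t ^ 2) pH)
    (hH0 : 0 < BICM.secondMoment pH) :
    C.mean = ∑ i, C.symbolProb i • C.x i ∧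
    C.energy = ∑ i, C.symbolProb i * ‖C.x i‖ ^ 2 ∧
    -- the mutual informations are expectations of integrable random variables
    (∀ r : ℝ, 0 ≤ r → ∀ N₀ : ℝ, 0 < N₀ → ∀ k,
      MeasureTheory.Integrable (BICM.infoDensity (C.scale r) N₀ k)
        (BICM.jointLaw (C.scale r) ν N₀)) ∧
    -- whether the noise level or the scale of the alphabet varies, the BICM-GMI is the same
    -- function of the SNR
    (∀ r : ℝ, 0 ≤ r → ∀ N₀ : ℝ, 0 < N₀ →
      BICM.bicmGMI (C.scale r) ν N₀ =
        BICM.gmiOfSNR C ν pH (BICM.snr (C.scale r) pH N₀)) ∧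
    -- the derivative of the BICM-GMI at zero SNR
    HasDerivWithinAt (BICM.gmiOfSNR C ν pH)
      (Real.logb 2 (Real.exp 1) / C.energy *
        ∑ i, C.symbolProb i * ∑ j, C.symbolProb j * inner ℝ (C.x i) (C.x j) *
          ∑ k, (-1) ^ ((BICM.nbc i k : ℕ) + (BICM.nbc j k : ℕ)) *
            (C.bitProb k (1 - BICM.nbc i k) / C.bitProb k (BICM.nbc j k)))
      (Set.Ici 0) 0 := by
  obtain ⟨hmean, hE, hint, hgmi, hderiv⟩ := theorem5_general C hC ν pH (fun l => by
    rw [BICM.secondMoment, ← hν l, integral_map (by fun_prop) (by fun_prop)]) hH0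
  exact ⟨hmean, hE, fun r _ => hint r, hgmi, hderiv⟩
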